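/- Let $A$ and $B$ be (complex, not necessarily unital) Banach algebras, each with a two-sided bounded approximate identity, and let $T:B\to A$ be an algebra homomorphism with $\|T\|\le 1$. Let $A\times_T B$ be the $T$-Lau product: the Banach algebra $A\times B$ with norm $\|(a,b)\|=\|a\|+\|b\|$ and multiplication $$(a,b)(c,d)=(ac+T(b)c+aT(d),\,bd).$$ As an algebra it is the direct product of its closed ideals $\{(a,0):a\in A\}\cong A$ and $\{(-T(b),b):b\in B\}\cong B$. Let $E$ be an essential Banach $A\times_T B$-bimodule, i.e. the linear spans of $(A\times_T B)\cdot E$ and of $E\cdot(A\times_T B)$ are both dense in $E$. Regard $E$ as a Banach $A$-bimodule and as a Banach $B$-bimodule by restriction to these two direct factors: $$a\cdot x=(a,0)\cdot x,\quad x\cdot a=x\cdot(a,0),\qquad b\cdot x=(-T(b),b)\cdot x,\quad x\cdot b=x\cdot(-T(b),b).$$ For a Banach algebra $C$ acting on $E$, give the dual $E^*$ the bimodule structure $(c\cdot f)(x)=f(x\cdot c)$, $(f\cdot c)(x)=f(c\cdot x)$, and let $\mathcal H^n(C,E^*)$ be the continuous Hochschild cohomology, that is, the space of bounded $n$-linear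 cocycles $C^n\to E^*$ modulo the coboundaries of bounded $(n-1)$-linear maps, for the differential $$(\delta^n f)(c_1,\dots,c_{n+1})=c_1\cdot f(c_2,\dots,c_{n+1})+\sum_{i=1}^{n}(-1)^i f(c_1,\dots,c_ic_{i+1},\dots,c_{n+1})+(-1)^{n+1}f(c_1,\dots,c_n)\cdot c_{n+1}.$$ Then for every $n\ge 1$ there is an isomorphism of vector spaces $$\mathcal H^n(A\times_T B,E^*)\simeq \mathcal H^n(A,E^*)\times \mathcal H^n(B,E^*).$$ -/

import Mathlib

open Filter Topology

noncomputable section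

/-- A (not necessarily unital) Banach algebra has a (two-sided) bounded approximate identity: a
bounded net `e` with `e * a → a` and `a * e → a` for all `a`, expressed through the filter of its
tails. -/
def HasBoundedApproxIdentity (A : Type*) [NonUnitalNormedRing A] : Prop :=
  ∃ l : Filter A, l.IsApproximateUnit ∧ ∃ K : ℝ, ∀ᶠ e in l, ‖e‖ ≤ K

/-- A structure of Banach `A`-bimodule on the complex normed space `E`: jointly bounded bilinear
left and right actions `a · x = lact a x` and `x · a = ract a x` which are associative and
commute with each other. -/
structure BanachBimodule (A E : Type*) [NonUnitalNormedRing A] [NormedSpace ℂ A]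
    [NormedAddCommGroup E] [NormedSpace ℂ E] where
  /-- The left action, `lact a x = a · x`. -/
  lact : A →L[ℂ] E →L[ℂ] E
  /-- The right action, `ract a x = x · a`. -/
  ract : A →L[ℂ] E →L[ℂ] E
  /-- `(ab) · x = a · (b · x)` -/
  lact_mul : ∀ (a b : A) (x : E), lact (a * b) x = lact a (lact b x)
  /-- `x · (ab) = (x · a) · b` -/
  ract_mul : ∀ (a b : A) (x : E), ract (a * b) x = ract b (ract a x)
  /-- `a · (x · b) = (a · x) · b` -/
  lact_ract : ∀ (a b : A) (x : E), lact a (ract b x) = ract b (lact a x)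

namespace BanachBimodule

section Basic

variable {A C E : Type*} [NonUnitalNormedRing A] [NormedSpace ℂ A]
  [NonUnitalNormedRing C] [NormedSpace ℂ C] [NormedAddCommGroup E] [NormedSpace ℂ E]

/-- `E` is essential: the linear spans of `A · E` and of `E · A` are both dense in `E`. -/
def IsEssential (M : BanachBimodule A E) : Prop :=
  Dense (Submodule.span ℂ {y : E | ∃ (a : A) (x : E), M.lact a x = y} : Set E) ∧
    Dense (Submodule.span ℂ {y : E | ∃ (a : A) (x : E), M.ract a x = y} : Set E)

/-- The dual bimodule `E*`, with `(a · f)(x) = f(x · a)` and `(f · a)(x) = f(a · x)`. -/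
def dual (M : BanachBimodule A E) : BanachBimodule A (E →L[ℂ] ℂ) where
  lact := ((ContinuousLinearMap.compL ℂ E E ℂ).flip).comp M.ract
  ract := ((ContinuousLinearMap.compL ℂ E E ℂ).flip).comp M.lact
  lact_mul a b f := by ext x; simp [M.ract_mul]
  ract_mul a b f := by ext x; simp [M.lact_mul]
  lact_ract a b f := by ext x; simp [M.lact_ract]

/-- Restriction of a bimodule structure along a continuous algebra homomorphism `φ : A → C`. -/
def restrict (M : BanachBimodule C E) (φ : A →L[ℂ] C) (hφ : ∀ a b, φ (a * b) = φ a * φ b) :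
    BanachBimodule A E where
  lact := M.lact.comp φ
  ract := M.ract.comp φ
  lact_mul a b x := by simp [hφ, M.lact_mul]
  ract_mul a b x := by simp [hφ, M.ract_mul]
  lact_ract a b x := by simp [M.lact_ract]

end Basic

/-! ### Continuous Hochschild cohomology -/

section Hochschild

/-- Contracting an updated tuple is updating the contracted tuple. -/
theorem contractNth_update {A : Type*} [Mul A] {n : ℕ} (j : Fin n) (a : Fin (n + 1) → A)
    (i : Fin (n + 1)) (x : A) :
    Fin.contractNth j.castSucc (· * ·) (Function.update a i x) =
      Function.update (Fin.contractNth j.castSucc (· * ·) a) (j.predAbove i)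
        (if i = j.castSucc then x * a j.succ else
          if i = j.succ then a j.castSucc * x else x) := by
  have hp : (j.predAbove i : ℕ) = if (j : ℕ) < i then (i : ℕ) - 1 else i := by
    unfold Fin.predAbove
    simp only [Fin.lt_def, Fin.val_castSucc]
    split_ifs <;> simp
  funext k
  generalize j.predAbove i = p at hp
  simp only [Fin.contractNth, Function.update_apply, Fin.ext_iff, Fin.val_castSucc, Fin.val_succ]
  have e1 : (k : ℕ) = j → k = j := Fin.ext
  split_ifs <;> first | rfl | (exfalso; split_ifs at hp <;> omega) | (rw [e1 (by omega)])

variable {A E : Type*} [NonUnitalNormedRing A] [NormedSpace ℂ A]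
  [NormedAddCommGroup E] [NormedSpace ℂ E]

/-- The cochain `(a_0, …, a_n) ↦ a_0 · f (a_1, …, a_n)`. -/
def leftCochain (M : BanachBimodule A E) {n : ℕ}
    (f : ContinuousMultilinearMap ℂ (fun _ : Fin n => A) E) :
    ContinuousMultilinearMap ℂ (fun _ : Fin (n + 1) => A) E :=
  ContinuousLinearMap.uncurryLeft
    (((ContinuousLinearMap.compContinuousMultilinearMapL ℂ (fun _ : Fin n => A) E E).flip f).comp
      M.lact)

/-- The cochain `(a_0, …, a_n) ↦ f (a_0, …, a_{n-1}) · a_n`. -/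
def rightCochain (M : BanachBimodule A E) {n : ℕ}
    (f : ContinuousMultilinearMap ℂ (fun _ : Fin n => A) E) :
    ContinuousMultilinearMap ℂ (fun _ : Fin (n + 1) => A) E :=
  ContinuousMultilinearMap.uncurryRight (M.ract.flip.compContinuousMultilinearMap f)

theorem leftCochain_apply (M : BanachBimodule A E) {n : ℕ}
    (f : ContinuousMultilinearMap ℂ (fun _ : Fin n => A) E) (a : Fin (n + 1) → A) :
    M.leftCochain f a = M.lact (a 0) (f (Fin.tail a)) := rfl

theorem rightCochain_apply (M : BanachBimodule A E) {n : ℕ}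
    (f : ContinuousMultilinearMap ℂ (fun _ : Fin n => A) E) (a : Fin (n + 1) → A) :
    M.rightCochain f a = M.ract (a (Fin.last n)) (f (Fin.init a)) := rfl

variable [IsScalarTower ℂ A A] [SMulCommClass ℂ A A]

/-- The cochain `(a_0, …, a_n) ↦ f (a_0, …, a_j a_{j+1}, …, a_n)`. -/
def contractCochain {n : ℕ} (j : Fin n) (f : ContinuousMultilinearMap ℂ (fun _ : Fin n => A) E) :
    ContinuousMultilinearMap ℂ (fun _ : Fin (n + 1) => A) E where
  toFun a := f (Fin.contractNth j.castSucc (· * ·) a)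
  map_update_add' := by
    intro inst a i x y
    obtain rfl : inst = instDecidableEqFin _ := Subsingleton.elim _ _
    simp only [contractNth_update]
    split_ifs <;> simp [add_mul, mul_add]
  map_update_smul' := by
    intro inst a i c x
    obtain rfl : inst = instDecidableEqFin _ := Subsingleton.elim _ _
    simp only [contractNth_update]
    split_ifs <;> simp [smul_mul_assoc, mul_smul_comm]
  cont := by
    refine f.cont.comp (continuous_pi fun k => ?_)
    unfold Fin.contractNth
    split_ifs <;> fun_prop

theorem contractCochain_apply {n : ℕ} (j : Fin n)
    (f : ContinuousMultilinearMap ℂ (fun _ : Fin n => A) E) (a : Fin (n + 1) → A) :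
    contractCochain j f a = f (Fin.contractNth j.castSucc (· * ·) a) := rfl

/-- The Hochschild coboundary `δⁿ : Cⁿ(A, E) → Cⁿ⁺¹(A, E)` on bounded multilinear maps,
`(δⁿ f)(a_0, …, a_n) = a_0 · f(a_1, …, a_n) + ∑_{j < n} (-1)^{j+1} f(…, a_j a_{j+1}, …)
+ (-1)^{n+1} f(a_0, …, a_{n-1}) · a_n`. -/
def coboundary (M : BanachBimodule A E) (n : ℕ) :
    ContinuousMultilinearMap ℂ (fun _ : Fin n => A) E →ₗ[ℂ]
      ContinuousMultilinearMap ℂ (fun _ : Fin (n + 1) => A) E where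
  toFun f := M.leftCochain f + ∑ j : Fin n, (-1 : ℂ) ^ ((j : ℕ) + 1) • contractCochain j f
    + (-1 : ℂ) ^ (n + 1) • M.rightCochain f
  map_add' f g := by
    ext a
    simp only [add_apply, sum_apply,
      smul_apply, leftCochain_apply, rightCochain_apply,
      contractCochain_apply, map_add, smul_add, Finset.sum_add_distrib]
    abel
  map_smul' c f := by
    ext a
    simp only [add_apply, sum_apply,
      smul_apply, leftCochain_apply, rightCochain_apply,
      contractCochain_apply, map_smul, smul_add, Finset.smul_sum, RingHom.id_apply, smul_comm _ c]

/-- The space `Zⁿ(A, E)` of bounded `n`-cocycles. -/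
def cocycles (M : BanachBimodule A E) (n : ℕ) :
    Submodule ℂ (ContinuousMultilinearMap ℂ (fun _ : Fin n => A) E) :=
  LinearMap.ker (M.coboundary n)

/-- The space `Bⁿ(A, E)` of bounded `n`-coboundaries. -/
def coboundaries (M : BanachBimodule A E) :
    (n : ℕ) → Submodule ℂ (ContinuousMultilinearMap ℂ (fun _ : Fin n => A) E)
  | 0 => ⊥
  | n + 1 => LinearMap.range (M.coboundary n)

/-- The continuous Hochschild cohomology `Hⁿ(A, E) = Zⁿ(A, E) / Bⁿ(A, E)`. -/
abbrev hochschild (M : BanachBimodule A E) (n : ℕ) : Type _ :=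
  M.cocycles n ⧸ (M.coboundaries n).submoduleOf (M.cocycles n)

end Hochschild

end BanachBimodule

/-! ### The `T`-Lau product -/

section LauProduct

variable {A B : Type*} [NonUnitalNormedRing A] [NormedSpace ℂ A]
  [NonUnitalNormedRing B] [NormedSpace ℂ B]

/-- The `T`-Lau product `A ×_T B` of two Banach algebras along a contractive algebra homomorphism
`T : B → A`: the space `A × B` with the norm `‖(a, b)‖ = ‖a‖ + ‖b‖` and the product
`(a, b) (c, d) = (a c + T(b) c + a T(d), b d)`. -/
def LauProduct (T : B →ₙₐ[ℂ] A) (_hT : ∀ b, ‖T b‖ ≤ ‖b‖) : Type _ := WithLp 1 (A × B)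

namespace LauProduct

variable {T : B →ₙₐ[ℂ] A} {hT : ∀ b, ‖T b‖ ≤ ‖b‖}

instance : NormedAddCommGroup (LauProduct T hT) :=
  inferInstanceAs (NormedAddCommGroup (WithLp 1 (A × B)))

instance : NormedSpace ℂ (LauProduct T hT) :=
  inferInstanceAs (NormedSpace ℂ (WithLp 1 (A × B)))

/-- The element `(a, b)` of `A ×_T B`. -/
def mk (a : A) (b : B) : LauProduct T hT := WithLp.toLp 1 (a, b)

/-- The first coordinate. -/
def fst (x : LauProduct T hT) : A := WithLp.fst (p := 1) (α := A) (β := B) x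

/-- The second coordinate. -/
def snd (x : LauProduct T hT) : B := WithLp.snd (p := 1) (α := A) (β := B) x

theorem ext' {x y : LauProduct T hT} (h1 : x.fst = y.fst) (h2 : x.snd = y.snd) : x = y :=
  WithLp.ofLp_injective 1 (Prod.ext h1 h2)

theorem norm_eq (x : LauProduct T hT) : ‖x‖ = ‖x.fst‖ + ‖x.snd‖ :=
  WithLp.prod_norm_eq_of_L1 (α := A) (β := B) x

instance : Mul (LauProduct T hT) :=
  ⟨fun x y => mk (x.fst * y.fst + T x.snd * y.fst + x.fst * T y.snd) (x.snd * y.snd)⟩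

theorem fst_mk (a : A) (b : B) : (mk a b : LauProduct T hT).fst = a := rfl
theorem snd_mk (a : A) (b : B) : (mk a b : LauProduct T hT).snd = b := rfl
theorem fst_add (x y : LauProduct T hT) : (x + y).fst = x.fst + y.fst := rfl
theorem snd_add (x y : LauProduct T hT) : (x + y).snd = x.snd + y.snd := rfl
theorem fst_zero : (0 : LauProduct T hT).fst = 0 := rfl
theorem snd_zero : (0 : LauProduct T hT).snd = 0 := rfl
theorem fst_smul (c : ℂ) (x : LauProduct T hT) : (c • x).fst = c • x.fst := rfl
theorem snd_smul (c : ℂ) (x : LauProduct T hT) : (c • x).snd = c • x.snd := rfl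
theorem fst_mul (x y : LauProduct T hT) :
    (x * y).fst = x.fst * y.fst + T x.snd * y.fst + x.fst * T y.snd := rfl
theorem snd_mul (x y : LauProduct T hT) : (x * y).snd = x.snd * y.snd := rfl

instance : NonUnitalNormedRing (LauProduct T hT) :=
  { (inferInstance : NormedAddCommGroup (LauProduct T hT)),
    (inferInstance : Mul (LauProduct T hT)) with
    left_distrib := fun x y z => by
      apply ext' <;> simp only [fst_mul, snd_mul, fst_add, snd_add, map_add, mul_add]
      abel
    right_distrib := fun x y z => by
      apply ext' <;> simp only [fst_mul, snd_mul, fst_add, snd_add, map_add, add_mul]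
      abel
    zero_mul := fun x => by
      apply ext' <;> simp [fst_mul, snd_mul, fst_zero, snd_zero]
    mul_zero := fun x => by
      apply ext' <;> simp [fst_mul, snd_mul, fst_zero, snd_zero]
    mul_assoc := fun x y z => by
      apply ext' <;> simp only [fst_mul, snd_mul, map_mul, mul_add, add_mul, mul_assoc]
      abel
    norm_mul_le := fun x y => by
      rw [norm_eq, norm_eq x, norm_eq y, fst_mul, snd_mul]
      have h1 := norm_add₃_le (a := x.fst * y.fst) (b := T x.snd * y.fst) (c := x.fst * T y.snd)
      have h2 := norm_mul_le x.fst y.fst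
      have h3 : ‖T x.snd * y.fst‖ ≤ ‖x.snd‖ * ‖y.fst‖ :=
        (norm_mul_le _ _).trans (mul_le_mul_of_nonneg_right (hT _) (norm_nonneg _))
      have h4 : ‖x.fst * T y.snd‖ ≤ ‖x.fst‖ * ‖y.snd‖ :=
        (norm_mul_le _ _).trans (mul_le_mul_of_nonneg_left (hT _) (norm_nonneg _))
      have h5 := norm_mul_le x.snd y.snd
      linarith [add_mul (‖x.fst‖) (‖x.snd‖) (‖y.fst‖ + ‖y.snd‖),
        mul_add (‖x.fst‖) (‖y.fst‖) (‖y.snd‖), mul_add (‖x.snd‖) (‖y.fst‖) (‖y.snd‖)] }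

instance [IsScalarTower ℂ A A] [IsScalarTower ℂ B B] :
    IsScalarTower ℂ (LauProduct T hT) (LauProduct T hT) :=
  ⟨fun c x y => by
    apply ext' <;>
      simp only [smul_eq_mul, fst_mul, snd_mul, fst_smul, snd_smul, map_smul, smul_mul_assoc,
        smul_add]⟩

instance [SMulCommClass ℂ A A] [SMulCommClass ℂ B B] :
    SMulCommClass ℂ (LauProduct T hT) (LauProduct T hT) :=
  ⟨fun c x y => by
    apply ext' <;>
      simp only [smul_eq_mul, fst_mul, snd_mul, fst_smul, snd_smul, map_smul, mul_smul_comm,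
        smul_add]⟩

instance [CompleteSpace A] [CompleteSpace B] : CompleteSpace (LauProduct T hT) :=
  inferInstanceAs (CompleteSpace (WithLp 1 (A × B)))

/-- The inclusion `a ↦ (a, 0)` of `A` as a closed ideal of `A ×_T B`. -/
def inlL (T : B →ₙₐ[ℂ] A) (hT : ∀ b, ‖T b‖ ≤ ‖b‖) : A →L[ℂ] LauProduct T hT :=
  LinearMap.mkContinuous
    { toFun := fun a => mk a 0
      map_add' := fun a b => by apply ext' <;> simp [fst_mk, snd_mk, fst_add, snd_add]
      map_smul' := fun c a => by apply ext' <;> simp [fst_mk, snd_mk, fst_smul, snd_smul] }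
    1 (fun a => by simp [norm_eq, fst_mk, snd_mk])

theorem inlL_mul (T : B →ₙₐ[ℂ] A) (hT : ∀ b, ‖T b‖ ≤ ‖b‖) (a b : A) :
    inlL T hT (a * b) = inlL T hT a * inlL T hT b := by
  apply ext' <;> simp [inlL, fst_mk, snd_mk, fst_mul, snd_mul]

/-- The inclusion `b ↦ (-T(b), b)` of `B` as a closed ideal of `A ×_T B`. Together with
`a ↦ (a, 0)` it exhibits `A ×_T B` as the direct product of the algebras `A` and `B`
(the isomorphism `A ×_T B ≅ A × B` being `(a, b) ↦ (a + T(b), b)`). -/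
def inrL (T : B →ₙₐ[ℂ] A) (hT : ∀ b, ‖T b‖ ≤ ‖b‖) : B →L[ℂ] LauProduct T hT :=
  LinearMap.mkContinuous
    { toFun := fun b => mk (-T b) b
      map_add' := fun a b => by
        apply ext' <;> simp only [fst_mk, snd_mk, fst_add, snd_add, map_add, neg_add]
      map_smul' := fun c a => by
        apply ext' <;> simp [fst_mk, snd_mk, fst_smul, snd_smul] }
    2 (fun b => by
      have := hT b
      simp only [LinearMap.coe_mk, AddHom.coe_mk, norm_eq, fst_mk, snd_mk, norm_neg]
      linarith)

theorem inrL_mul (T : B →ₙₐ[ℂ] A) (hT : ∀ b, ‖T b‖ ≤ ‖b‖) (a b : B) :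
    inrL T hT (a * b) = inrL T hT a * inrL T hT b := by
  apply ext' <;> simp [inrL, fst_mk, snd_mk, fst_mul, snd_mul]

end LauProduct

end LauProduct

namespace BanachBimodule

variable {A B E : Type*} [NonUnitalNormedRing A] [NormedSpace ℂ A]
  [NonUnitalNormedRing B] [NormedSpace ℂ B] [NormedAddCommGroup E] [NormedSpace ℂ E]
  {T : B →ₙₐ[ℂ] A} {hT : ∀ b, ‖T b‖ ≤ ‖b‖}

/-- The Banach `A`-bimodule underlying an `A ×_T B`-bimodule: `a · x = (a, 0) · x` and
`x · a = x · (a, 0)`. -/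
def toLeftFactor (M : BanachBimodule (LauProduct T hT) E) : BanachBimodule A E :=
  M.restrict (LauProduct.inlL T hT) (LauProduct.inlL_mul T hT)

/-- The Banach `B`-bimodule underlying an `A ×_T B`-bimodule: `b · x = (-T(b), b) · x` and
`x · b = x · (-T(b), b)`. -/
def toRightFactor (M : BanachBimodule (LauProduct T hT) E) : BanachBimodule B E :=
  M.restrict (LauProduct.inrL T hT) (LauProduct.inrL_mul T hT)

end BanachBimodule

end

/-!
Write `D` for the algebra `A ×_T B`, a direct product of its ideals `A` and `B`. If `A` and `B` were
unital, their units would be complementary central idempotents of `D`, and cochains on `D` could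
be cut into pieces with them. Here a weak* cluster point `m` of a bounded approximate identity
of `A` in the bidual `A**` plays the part of the unit
(`HasBoundedApproxIdentity.exists_mixedIdentity`). Every bounded linear map from `D` to the dual
module `E*` has a weak* value at `m`, and this is enough to insert `m` as an argument of a cochain
and to multiply elements of `E*` by `m` on either side, with the algebraic rules that a central
idempotent of `D` obeys. The structure `VirtualIdempotent` records these rules.

For such an `m`, the multiplicative maps `c ↦ m c` and `c ↦ c` of `D` to itself are intertwined by
`m`, so they induce homotopic maps on cochains. The homotopy is the alternating sum over `i` of
`f (m a_0, …, m a_{i-1}, m, a_i, …, a_{n-1})`, and `prism_homotopy` identifies its boundary for a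
cocycle `f` whose values lie in `m · E*`: it is `m · f - f(m a_0, …, m a_n) · m`. Consequently
`m · f` is cohomologous to `m · f(m a_0, …, m a_n) · m` for every cocycle `f`
(`left_sub_corner_mem_coboundaries`).

Let `p` and `q` be the idempotents belonging to `A` and `B`. Since `E · D` spans a dense subspace
of `E`, the left actions of `p` and `q` on `E*` add up to the identity (`left_add_left`). Every
cocycle `f` on `D` of positive degree is therefore cohomologous to the sum of
`p · f(p a_0, …) · p` and `q · f(q a_0, …) · q`, which is the result of restricting `f` to `A` and
to `B` and then extending the two restrictions `g` and `h` to `D` as `p · g(p a_0, …) · p` and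
`q · h(q a_0, …) · q`. In the other direction, extending `g` from `A` to `D` and then restricting
gives `p · g · p` on `A` and zero on `B`. Over `A`, where `p` is a unit, `p · g · p` is cohomologous
to `p · g`, again by the prism homotopy, and `p · g` is cohomologous to `g`: the difference takes
values in a module on which `A` acts trivially from the left, so insertion of `p` as the first
argument contracts it (`insertHead_homotopy`). The degree has to be positive for this last step.
-/

noncomputable section

/-! ### Splitting off the first argument of a cochain -/

namespace BanachBimodule

section Cochains

variable {D X : Type*} [NonUnitalNormedRing D] [NormedSpace ℂ D]
  [IsScalarTower ℂ D D] [SMulCommClass ℂ D D] [NormedAddCommGroup X] [NormedSpace ℂ X]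

theorem coboundary_apply (N : BanachBimodule D X) {n : ℕ}
    (f : ContinuousMultilinearMap ℂ (fun _ : Fin n => D) X) (v : Fin (n + 1) → D) :
    N.coboundary n f v = N.lact (v 0) (f (Fin.tail v))
      + ∑ j : Fin n, (-1 : ℂ) ^ ((j : ℕ) + 1) • f (Fin.contractNth j.castSucc (· * ·) v)
      + (-1 : ℂ) ^ (n + 1) • N.ract (v (Fin.last n)) (f (Fin.init v)) := by
  simp [coboundary, leftCochain_apply, rightCochain_apply, contractCochain_apply]

theorem coboundary_zero_apply (N : BanachBimodule D X)
    (f : ContinuousMultilinearMap ℂ (fun _ : Fin 0 => D) X) (v : Fin 1 → D) :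
    N.coboundary 0 f v = N.lact (v 0) (f 0) - N.ract (v 0) (f 0) := by
  rw [coboundary_apply, Subsingleton.elim (Fin.tail v) 0, Subsingleton.elim (Fin.init v) 0]
  simp [sub_eq_add_neg]

theorem contractNth_zero_cons {D : Type*} [Mul D] {n : ℕ} (c : D) (v : Fin (n + 1) → D) :
    Fin.contractNth (0 : Fin (n + 2)) (· * ·) (Fin.cons c v : Fin (n + 2) → D) =
      Fin.cons (c * v 0) (Fin.tail v) := by
  funext k
  refine Fin.cases ?_ (fun k => ?_) k
  · rw [Fin.contractNth_apply_of_eq _ _ _ _ rfl]; simp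
  · rw [Fin.contractNth_apply_of_gt _ _ _ _ (by simp)]; simp [Fin.tail]

theorem contractNth_succ_cons {D : Type*} [Mul D] {n : ℕ} (j : Fin (n + 1)) (c : D)
    (v : Fin (n + 1) → D) :
    Fin.contractNth j.succ (· * ·) (Fin.cons c v : Fin (n + 2) → D) =
      Fin.cons c (Fin.contractNth j (· * ·) v) := by
  funext k
  refine Fin.cases ?_ (fun k => ?_) k
  · rw [Fin.contractNth_apply_of_lt _ _ _ _ (by simp)]; simp
  · simp [Fin.contractNth, Fin.cons_succ]

/-- Fixing the first argument `c` anticommutes with the coboundary, apart from the terms in which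
`c` acts or is multiplied and the term with the left action of the next argument. -/
theorem coboundary_cons (N : BanachBimodule D X) {n : ℕ}
    (f : ContinuousMultilinearMap ℂ (fun _ : Fin (n + 1) => D) X) (c : D) (v : Fin (n + 1) → D) :
    N.coboundary (n + 1) f (Fin.cons c v) = N.lact c (f v) - f (Fin.cons (c * v 0) (Fin.tail v))
      + N.lact (v 0) (f (Fin.cons c (Fin.tail v))) - N.coboundary n (f.curryLeft c) v := by
  have hinit : Fin.init (Fin.cons c v : Fin (n + 2) → D) = Fin.cons c (Fin.init v) := by
    funext k
    refine Fin.cases ?_ (fun k => ?_) k <;> simp [Fin.init]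
  rw [coboundary_apply, coboundary_apply, Fin.sum_univ_succ, hinit, ← Fin.succ_last]
  simp only [Fin.cons_zero, Fin.tail_cons, Fin.cons_succ, Fin.castSucc_zero, Fin.val_zero,
    contractNth_zero_cons, ← Fin.succ_castSucc, contractNth_succ_cons, Fin.val_succ,
    ContinuousMultilinearMap.curryLeft_apply, pow_succ _ (_ + 1), mul_neg_one, neg_smul,
    Finset.sum_neg_distrib]
  simp
  abel

/-- The cochain `(a_0, a_1, …, a_n) ↦ f (c a_0, a_1, …, a_n)`. -/
def mulHead {n : ℕ} (c : D) (f : ContinuousMultilinearMap ℂ (fun _ : Fin (n + 1) => D) X) :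
    ContinuousMultilinearMap ℂ (fun _ : Fin (n + 1) => D) X :=
  (f.curryLeft.comp (ContinuousLinearMap.mul ℂ D c)).uncurryLeft

theorem mulHead_apply {n : ℕ} (c : D)
    (f : ContinuousMultilinearMap ℂ (fun _ : Fin (n + 1) => D) X) (v : Fin (n + 1) → D) :
    mulHead c f v = f (Fin.cons (c * v 0) (Fin.tail v)) := rfl

theorem curryLeft_coboundary (N : BanachBimodule D X) {n : ℕ}
    (f : ContinuousMultilinearMap ℂ (fun _ : Fin (n + 1) => D) X) (c : D) :
    (N.coboundary (n + 1) f).curryLeft c = (N.lact c).compContinuousMultilinearMap f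
      - mulHead c f + N.leftCochain (f.curryLeft c) - N.coboundary n (f.curryLeft c) := by
  ext v
  simp [coboundary_cons, mulHead_apply, leftCochain_apply]

end Cochains

/-! ### Maps of cochains and of cohomology -/

section CochainMap

variable {D D' X X' : Type*} [NonUnitalNormedRing D] [NormedSpace ℂ D]
  [NonUnitalNormedRing D'] [NormedSpace ℂ D'] [NormedAddCommGroup X] [NormedSpace ℂ X]
  [NormedAddCommGroup X'] [NormedSpace ℂ X']

/-- The map `f ↦ u ∘ f ∘ (φ × ⋯ × φ)` on bounded cochains. -/
def cochainMap (φ : D' →L[ℂ] D) (u : X →L[ℂ] X') (n : ℕ) :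
    ContinuousMultilinearMap ℂ (fun _ : Fin n => D) X →ₗ[ℂ]
      ContinuousMultilinearMap ℂ (fun _ : Fin n => D') X' where
  toFun f := u.compContinuousMultilinearMap (f.compContinuousLinearMap fun _ => φ)
  map_add' f g := by ext v; simp
  map_smul' c f := by ext v; simp

theorem cochainMap_apply (φ : D' →L[ℂ] D) (u : X →L[ℂ] X') {n : ℕ}
    (f : ContinuousMultilinearMap ℂ (fun _ : Fin n => D) X) (v : Fin n → D') :
    cochainMap φ u n f v = u (f (φ ∘ v)) := rfl

/-- The pair of `φ : D' → D` and `u : X → X'` is compatible with the bimodule structures: `φ` is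
multiplicative, and `u` is a homomorphism of bimodules from the `D'`-bimodule obtained from the
`D`-bimodule `X` along `φ`. -/
structure IsCompatible (N : BanachBimodule D X) (N' : BanachBimodule D' X')
    (φ : D' →L[ℂ] D) (u : X →L[ℂ] X') : Prop where
  map_mul : ∀ a b, φ (a * b) = φ a * φ b
  map_lact : ∀ a x, u (N.lact (φ a) x) = N'.lact a (u x)
  map_ract : ∀ a x, u (N.ract (φ a) x) = N'.ract a (u x)

variable [IsScalarTower ℂ D D] [SMulCommClass ℂ D D] [IsScalarTower ℂ D' D'] [SMulCommClass ℂ D' D']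
  {N : BanachBimodule D X} {N' : BanachBimodule D' X'} {φ : D' →L[ℂ] D} {u : X →L[ℂ] X'}

theorem IsCompatible.coboundary_cochainMap (h : IsCompatible N N' φ u) {n : ℕ}
    (f : ContinuousMultilinearMap ℂ (fun _ : Fin n => D) X) :
    N'.coboundary n (cochainMap φ u n f) = cochainMap φ u (n + 1) (N.coboundary n f) := by
  ext v
  simp only [cochainMap_apply, coboundary_apply, map_add, map_sum, map_smul, Function.comp_apply,
    h.map_lact, h.map_ract, Fin.comp_contractNth (· * ·) (· * ·) h.map_mul]
  rfl

theorem IsCompatible.map_cocycles (h : IsCompatible N N' φ u) (n : ℕ) :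
    N.cocycles n ≤ (N'.cocycles n).comap (cochainMap φ u n) := by
  intro f hf
  rw [cocycles, LinearMap.mem_ker] at hf
  rw [Submodule.mem_comap, cocycles, LinearMap.mem_ker, h.coboundary_cochainMap, hf, map_zero]

theorem IsCompatible.map_coboundaries (h : IsCompatible N N' φ u) (n : ℕ) :
    N.coboundaries n ≤ (N'.coboundaries n).comap (cochainMap φ u n) := by
  cases n with
  | zero => exact bot_le
  | succ n =>
    rintro _ ⟨f, rfl⟩
    exact ⟨cochainMap φ u n f, h.coboundary_cochainMap f⟩

/-- The map induced on cohomology by a compatible pair. -/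
def hochschildMap (h : IsCompatible N N' φ u) (n : ℕ) : N.hochschild n →ₗ[ℂ] N'.hochschild n :=
  Submodule.mapQ _ _ ((cochainMap φ u n).restrict (h.map_cocycles n))
    fun _ hf => h.map_coboundaries n hf

end CochainMap

/-! ### Virtual central idempotents -/

/-- A central idempotent `m` of the bidual of `D` whose multiplication maps `D` to itself, seen
through its effect on bounded linear maps from `D` to the bimodule `X`: such a map `φ` has a value
`eval φ ∈ X` at `m`, and `proj c = m c = c m`. -/
structure VirtualIdempotent {D X : Type*} [NonUnitalNormedRing D] [NormedSpace ℂ D]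
    [IsScalarTower ℂ D D] [SMulCommClass ℂ D D] [NormedAddCommGroup X] [NormedSpace ℂ X]
    (N : BanachBimodule D X) where
  /-- The value at the idempotent of a bounded linear map. -/
  eval : (D →L[ℂ] X) →L[ℂ] X
  /-- Multiplication by the idempotent. -/
  proj : D →L[ℂ] D
  proj_mul : ∀ c d, proj (c * d) = proj c * proj d
  proj_proj : ∀ c, proj (proj c) = proj c
  eval_comp_proj : ∀ φ, eval (φ.comp proj) = eval φ
  eval_mul_left : ∀ (φ : D →L[ℂ] X) (c : D),
    eval (φ.comp (ContinuousLinearMap.mul ℂ D c)) = φ (proj c)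
  eval_mul_right : ∀ (φ : D →L[ℂ] X) (c : D),
    eval (φ.comp ((ContinuousLinearMap.mul ℂ D).flip c)) = φ (proj c)
  eval_lact : ∀ (φ : D →L[ℂ] X) (c : D), eval ((N.lact c).comp φ) = N.lact c (eval φ)
  eval_ract : ∀ (φ : D →L[ℂ] X) (c : D), eval ((N.ract c).comp φ) = N.ract c (eval φ)

namespace VirtualIdempotent

variable {D X : Type*} [NonUnitalNormedRing D] [NormedSpace ℂ D]
  [IsScalarTower ℂ D D] [SMulCommClass ℂ D D] [NormedAddCommGroup X] [NormedSpace ℂ X]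
  {N : BanachBimodule D X} (m : N.VirtualIdempotent)

/-- The left action of the idempotent on the bimodule. -/
def left : X →L[ℂ] X := m.eval.comp N.lact.flip

/-- The right action of the idempotent on the bimodule. -/
def right : X →L[ℂ] X := m.eval.comp N.ract.flip

theorem left_apply (x : X) : m.left x = m.eval (N.lact.flip x) := rfl

theorem right_apply (x : X) : m.right x = m.eval (N.ract.flip x) := rfl

theorem left_lact (c : D) (x : X) : m.left (N.lact c x) = N.lact (m.proj c) x := by
  rw [left_apply, ← ContinuousLinearMap.flip_apply N.lact (m.proj c) x, ← m.eval_mul_right]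
  congr 1
  ext d
  exact (N.lact_mul d c x).symm

theorem lact_left (c : D) (x : X) : N.lact c (m.left x) = N.lact (m.proj c) x := by
  rw [left_apply, ← ContinuousLinearMap.flip_apply N.lact (m.proj c) x, ← m.eval_mul_left,
    ← m.eval_lact]
  congr 1
  ext d
  exact (N.lact_mul c d x).symm

theorem left_ract (c : D) (x : X) : m.left (N.ract c x) = N.ract c (m.left x) := by
  rw [left_apply, left_apply, ← m.eval_ract]
  congr 1
  ext d
  exact N.lact_ract d c x

theorem right_ract (c : D) (x : X) : m.right (N.ract c x) = N.ract (m.proj c) x := by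
  rw [right_apply, ← ContinuousLinearMap.flip_apply N.ract (m.proj c) x, ← m.eval_mul_left]
  congr 1
  ext d
  exact (N.ract_mul c d x).symm

theorem ract_right (c : D) (x : X) : N.ract c (m.right x) = N.ract (m.proj c) x := by
  rw [right_apply, ← ContinuousLinearMap.flip_apply N.ract (m.proj c) x, ← m.eval_mul_right,
    ← m.eval_ract]
  congr 1
  ext d
  exact (N.ract_mul d c x).symm

theorem right_lact (c : D) (x : X) : m.right (N.lact c x) = N.lact c (m.right x) := by
  rw [right_apply, right_apply, ← m.eval_lact]
  congr 1
  ext d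
  exact (N.lact_ract c d x).symm

theorem left_left (x : X) : m.left (m.left x) = m.left x := by
  refine Eq.trans (congrArg m.eval ?_) (m.eval_comp_proj (N.lact.flip x))
  ext d
  exact m.lact_left d x

theorem isCompatible_left : IsCompatible N N (.id ℂ D) m.left where
  map_mul _ _ := rfl
  map_lact c x := by rw [lact_left]; exact m.left_lact c x
  map_ract c x := m.left_ract c x

/-! ### The contracting homotopies -/

/-- The cochain `(a_0, …, a_{n-1}) ↦ f (m, a_0, …, a_{n-1})`. -/
def insertHead (n : ℕ) : ContinuousMultilinearMap ℂ (fun _ : Fin (n + 1) => D) X →L[ℂ]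
    ContinuousMultilinearMap ℂ (fun _ : Fin n => D) X :=
  (ContinuousLinearMap.compContinuousMultilinearMapL ℂ (fun _ : Fin n => D) _ _ m.eval).comp
    ((ContinuousLinearMap.flipMultilinearEquiv ℂ (fun _ : Fin n => D) D
        X).toContinuousLinearMap.comp
      (continuousMultilinearCurryLeftEquiv ℂ (fun _ : Fin (n + 1) => D)
        X).toContinuousLinearEquiv.toContinuousLinearMap)

theorem insertHead_apply {n : ℕ}
    (f : ContinuousMultilinearMap ℂ (fun _ : Fin (n + 1) => D) X) (v : Fin n → D) :
    m.insertHead n f v = m.eval (f.curryLeft.flipMultilinear v) := rfl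

/-- The prism operator: the cochain whose value at `(a_0, …, a_{n-1})` is the alternating sum over
`i ≤ n` of `f (m a_0, …, m a_{i-1}, m, a_i, …, a_{n-1})`. The recursion separates the term `i = 0`
from the others, in which `m a_0` is the first argument. -/
def prism : (n : ℕ) → ContinuousMultilinearMap ℂ (fun _ : Fin (n + 1) => D) X →L[ℂ]
    ContinuousMultilinearMap ℂ (fun _ : Fin n => D) X
  | 0 => m.insertHead 0
  | n + 1 => m.insertHead (n + 1) -
      (continuousMultilinearCurryLeftEquiv ℂ (fun _ : Fin (n + 1) => D)
        X).toContinuousLinearEquiv.symm.toContinuousLinearMap ∘L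
      (prism n).postcomp D ∘L m.proj.precomp _ ∘L
      (continuousMultilinearCurryLeftEquiv ℂ (fun _ : Fin (n + 2) => D)
        X).toContinuousLinearEquiv.toContinuousLinearMap

theorem prism_succ_apply {n : ℕ}
    (f : ContinuousMultilinearMap ℂ (fun _ : Fin (n + 2) => D) X) (v : Fin (n + 1) → D) :
    m.prism (n + 1) f v =
      m.insertHead (n + 1) f v - m.prism n (f.curryLeft (m.proj (v 0))) (Fin.tail v) := rfl

theorem insertHead_lact {n : ℕ}
    (f : ContinuousMultilinearMap ℂ (fun _ : Fin (n + 1) => D) X) (c : D) :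
    m.insertHead n ((N.lact c).compContinuousMultilinearMap f) =
      (N.lact c).compContinuousMultilinearMap (m.insertHead n f) := by
  ext v
  exact m.eval_lact (f.curryLeft.flipMultilinear v) c

theorem prism_lact : ∀ {n : ℕ}
    (f : ContinuousMultilinearMap ℂ (fun _ : Fin (n + 1) => D) X) (c : D),
    m.prism n ((N.lact c).compContinuousMultilinearMap f) =
      (N.lact c).compContinuousMultilinearMap (m.prism n f)
  | 0, f, c => m.insertHead_lact f c
  | n + 1, f, c => by
    ext v
    have h := congrArg (· (Fin.tail v)) (prism_lact (f.curryLeft (m.proj (v 0))) c)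
    rw [prism_succ_apply, insertHead_lact]
    refine (congrArg₂ (· - ·) rfl h).trans ?_
    exact (map_sub (N.lact c) _ _).symm

/-- Insertion of `m` as the first argument anticommutes with the coboundary, apart from the terms in
which `m` acts or is multiplied and the term with the left action of `a_0`. -/
theorem insertHead_coboundary {n : ℕ}
    (f : ContinuousMultilinearMap ℂ (fun _ : Fin (n + 1) => D) X) (v : Fin (n + 1) → D) :
    m.insertHead (n + 1) (N.coboundary (n + 1) f) v =
      m.left (f v) - f (Fin.cons (m.proj (v 0)) (Fin.tail v))
      + N.lact (v 0) (m.insertHead n f (Fin.tail v)) - N.coboundary n (m.insertHead n f) v := by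
  set F := f.curryLeft.flipMultilinear with hF
  -- `G` is the map `d ↦ δⁿ (f (d, ·)) v`.
  obtain ⟨G, hG, hG'⟩ : ∃ G : D →L[ℂ] X, (∀ d, G d = N.coboundary n (f.curryLeft d) v) ∧
      m.eval G = N.coboundary n (m.insertHead n f) v := by
    refine ⟨(N.lact (v 0)).comp (F (Fin.tail v))
      + ∑ j : Fin n, (-1 : ℂ) ^ ((j : ℕ) + 1) • F (Fin.contractNth j.castSucc (· * ·) v)
      + (-1 : ℂ) ^ (n + 1) • (N.ract (v (Fin.last n))).comp (F (Fin.init v)), ?_, ?_⟩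
    · intro d
      simp [coboundary_apply, hF]
    · simp only [coboundary_apply, insertHead_apply, map_add, map_sum, map_smul,
        m.eval_lact, m.eval_ract, hF]
  have key : (N.coboundary (n + 1) f).curryLeft.flipMultilinear v =
      N.lact.flip (f v) - (F (Fin.tail v)).comp ((ContinuousLinearMap.mul ℂ D).flip (v 0))
        + (N.lact (v 0)).comp (F (Fin.tail v)) - G := by
    ext d
    have h := N.coboundary_cons f d v
    rw [← hG] at h
    exact h
  rw [insertHead_apply, key, map_sub, map_add, map_sub, m.eval_mul_right, m.eval_lact, hG']
  rfl

theorem prism_coboundary_zero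
    (f : ContinuousMultilinearMap ℂ (fun _ : Fin 0 => D) X) (v : Fin 0 → D) :
    m.prism 0 (N.coboundary 0 f) v = m.left (f v) - m.right (f v) := by
  refine (m.insertHead_apply _ _).trans ?_
  rw [left_apply, right_apply, ← map_sub]
  congr 1
  ext d
  rw [Subsingleton.elim v 0]
  exact N.coboundary_zero_apply f _

theorem insertHead_mulHead {n : ℕ}
    (f : ContinuousMultilinearMap ℂ (fun _ : Fin (n + 1) => D) X) (c : D) (v : Fin n → D) :
    m.insertHead n (mulHead c f) v = f (Fin.cons (m.proj c) v) :=
  m.eval_mul_left (f.curryLeft.flipMultilinear v) c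

/-- The prism operator anticommutes with `leftCochain`, up to the left action of `m`. -/
theorem prism_leftCochain {n : ℕ}
    (f : ContinuousMultilinearMap ℂ (fun _ : Fin (n + 1) => D) X)
    (hf : ∀ c v, N.lact c (f v) = N.lact (m.proj c) (f v)) (v : Fin (n + 1) → D) :
    m.prism (n + 1) (N.leftCochain f) v + N.lact (v 0) (m.prism n f (Fin.tail v)) =
      m.left (f v) := by
  have h : (N.lact (m.proj (v 0))).compContinuousMultilinearMap f =
      (N.lact (v 0)).compContinuousMultilinearMap f := by
    ext w
    exact (hf _ _).symm
  have h' : m.prism n ((N.leftCochain f).curryLeft (m.proj (v 0))) (Fin.tail v) =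
      N.lact (v 0) (m.prism n f (Fin.tail v)) := by
    change m.prism n ((N.lact (m.proj (v 0))).compContinuousMultilinearMap f) _ = _
    rw [h, prism_lact]
    rfl
  rw [prism_succ_apply, h', sub_add_cancel]
  rfl

/-- The cochain `insertHead f - prism f` consists of the terms of `- prism f` other than the first
one. In the boundary of the prism, its value at `c a_0` cancels against the prism of
`f (m c ·, …)` except for one term. -/
theorem prism_mulHead {n : ℕ}
    (f : ContinuousMultilinearMap ℂ (fun _ : Fin (n + 2) => D) X) (c : D) (v : Fin (n + 1) → D) :
    m.prism (n + 1) (mulHead (m.proj c) f) v + (m.insertHead (n + 1) f - m.prism (n + 1) f)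
        (Fin.cons (c * v 0) (Fin.tail v)) = f (Fin.cons (m.proj c) v) := by
  have h : ((mulHead (m.proj c) f).curryLeft (m.proj (v 0))) =
      f.curryLeft (m.proj (c * v 0)) := by
    rw [m.proj_mul]; rfl
  rw [prism_succ_apply, insertHead_mulHead, m.proj_proj, sub_apply, prism_succ_apply, h]
  simp

/-- Cochains with values in `m · X` (on which `c` and `m c` act in the same way from the left) have
prisms of the same kind. -/
theorem lact_prism {n : ℕ} (f : ContinuousMultilinearMap ℂ (fun _ : Fin (n + 1) => D) X)
    (hf : ∀ c v, N.lact c (f v) = N.lact (m.proj c) (f v)) (c : D) (v : Fin n → D) :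
    N.lact c (m.prism n f v) = N.lact (m.proj c) (m.prism n f v) := by
  have h : (N.lact c).compContinuousMultilinearMap f =
      (N.lact (m.proj c)).compContinuousMultilinearMap f := by
    ext w
    exact hf _ _
  have h' := m.prism_lact f c
  rw [h, prism_lact] at h'
  exact (congrArg (· v) h').symm

/-- The prism operator is a homotopy between `m · f` and `f (m a_0, …, m a_n) · m`, provided that
`c` and `m c` act in the same way from the left on the values of `f`. The induction splits off
the first argument. -/
theorem prism_homotopy : ∀ {n : ℕ} (f : ContinuousMultilinearMap ℂ (fun _ : Fin (n + 1) => D) X)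
    (_ : ∀ c v, N.lact c (f v) = N.lact (m.proj c) (f v)) (v : Fin (n + 1) → D),
    m.prism (n + 1) (N.coboundary (n + 1) f) v + N.coboundary n (m.prism n f) v =
      m.left (f v) - m.right (f (m.proj ∘ v))
  | 0, f, hf, v => by
    have hv : (Fin.cons (m.proj (v 0)) (Fin.tail v) : Fin 1 → D) = m.proj ∘ v := by
      funext i
      rw [Fin.fin_one_eq_zero i]
      rfl
    have h1 : m.prism 0 ((N.lact (m.proj (v 0))).compContinuousMultilinearMap f) (Fin.tail v) =
        N.lact (v 0) (m.prism 0 f (Fin.tail v)) := by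
      rw [m.lact_prism f hf, prism_lact]
      rfl
    have h2 : m.prism 0 (mulHead (m.proj (v 0)) f) (Fin.tail v) = f (m.proj ∘ v) := by
      refine (m.insertHead_mulHead _ _ _).trans ?_
      rw [m.proj_proj, hv]
    have h3 : m.prism 0 (N.leftCochain (f.curryLeft (m.proj (v 0)))) (Fin.tail v) =
      m.left (f.curryLeft (m.proj (v 0)) (Fin.tail v)) := rfl
    rw [prism_succ_apply, insertHead_coboundary, curryLeft_coboundary, map_sub, map_add, map_sub,
      sub_apply, add_apply, sub_apply, h1, h2, h3, prism_coboundary_zero,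
      ContinuousMultilinearMap.curryLeft_apply, hv]
    change _ - _ + N.lact (v 0) (m.prism 0 f (Fin.tail v)) - N.coboundary 0 (m.prism 0 f) v - _ + _
      = _
    abel
  | n + 1, f, hf, v => by
    have h1 : m.prism (n + 1) ((N.lact (m.proj (v 0))).compContinuousMultilinearMap f)
        (Fin.tail v) = N.lact (v 0) (m.prism (n + 1) f (Fin.tail v)) := by
      rw [m.lact_prism f hf, prism_lact]
      rfl
    have h2 := m.prism_mulHead f (v 0) (Fin.tail v)
    have hf' : ∀ c w, N.lact c (f.curryLeft (m.proj (v 0)) w) =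
      N.lact (m.proj c) (f.curryLeft (m.proj (v 0)) w) := fun c w => hf c _
    have h3 := m.prism_leftCochain (f.curryLeft (m.proj (v 0))) hf' (Fin.tail v)
    have h4 := prism_homotopy (f.curryLeft (m.proj (v 0))) hf' (Fin.tail v)
    have hv : (Fin.cons (m.proj (v 0)) (m.proj ∘ Fin.tail v) : Fin (n + 2) → D) = m.proj ∘ v := by
      funext i
      refine Fin.cases ?_ (fun i => ?_) i <;> rfl
    -- The terms of the prism other than the first one form the cochain `-r`.
    set r := m.insertHead (n + 1) f - m.prism (n + 1) f with hr
    have hrc (c : D) : r.curryLeft c = m.prism n (f.curryLeft (m.proj c)) := by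
      ext w
      rw [ContinuousMultilinearMap.curryLeft_apply, hr, sub_apply, prism_succ_apply, sub_sub_cancel]
      rfl
    have h5 := N.coboundary_cons r (v 0) (Fin.tail v)
    have hrc' (w : Fin n → D) : r (Fin.cons (v 0) w) = r.curryLeft (v 0) w := rfl
    rw [hrc', hrc, Fin.cons_self_tail] at h5
    rw [hr, map_sub, sub_apply, sub_apply, map_sub, ← hr] at h5
    rw [ContinuousMultilinearMap.curryLeft_apply] at h3 h4
    rw [ContinuousMultilinearMap.curryLeft_apply, hv] at h4
    rw [prism_succ_apply, insertHead_coboundary, curryLeft_coboundary, map_sub, map_add, map_sub,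
      sub_apply, add_apply, sub_apply, h1]
    rw [sub_eq_iff_eq_add] at h5
    rw [h5, ← h2, eq_sub_of_add_eq h3, eq_sub_of_add_eq h4]
    abel

/-- If `m` is a unit, insertion of `m` as the first argument contracts the cochains with values on
which the algebra acts trivially from the left. -/
theorem insertHead_homotopy (hm : ∀ c, m.proj c = c) {n : ℕ}
    (f : ContinuousMultilinearMap ℂ (fun _ : Fin (n + 1) => D) X)
    (hf : ∀ c v, N.lact c (f v) = 0) :
    m.insertHead (n + 1) (N.coboundary (n + 1) f) + N.coboundary n (m.insertHead n f) = -f := by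
  ext v
  have h : N.lact (v 0) (m.insertHead n f (Fin.tail v)) = 0 := by
    have h0 : (N.lact (v 0)).compContinuousMultilinearMap f = 0 := by
      ext w
      exact hf _ _
    have h1 := m.insertHead_lact f (v 0)
    rw [h0, map_zero] at h1
    exact (congrArg (· (Fin.tail v)) h1).symm
  have h' : m.left (f v) = 0 := by
    have h0 : N.lact.flip (f v) = 0 := by
      ext d
      exact hf _ _
    rw [left_apply, h0, map_zero]
  rw [add_apply, insertHead_coboundary, h, h', hm, Fin.cons_self_tail]
  simp

end VirtualIdempotent
end BanachBimodule

/-! ### Units of direct factors -/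

section MixedIdentity

variable {A : Type*} [NonUnitalNormedRing A] [NormedSpace ℂ A]
  [IsScalarTower ℂ A A] [SMulCommClass ℂ A A]

/-- A weak* cluster point of a bounded approximate identity is a mixed identity of the bidual. -/
theorem HasBoundedApproxIdentity.exists_mixedIdentity (hA : HasBoundedApproxIdentity A) :
    ∃ μ : (A →L[ℂ] ℂ) →L[ℂ] ℂ, ∀ (ψ : A →L[ℂ] ℂ) (a : A),
      μ (ψ.comp (ContinuousLinearMap.mul ℂ A a)) = ψ a ∧
        μ (ψ.comp ((ContinuousLinearMap.mul ℂ A).flip a)) = ψ a := by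
  obtain ⟨l, hl, K, hK⟩ := hA
  have := hl.neBot
  let U := Ultrafilter.of l
  have hU : (U : Filter A) ≤ l := Ultrafilter.of_le l
  let J : A → WeakDual ℂ (A →L[ℂ] ℂ) := fun a =>
    StrongDual.toWeakDual (NormedSpace.inclusionInDoubleDual ℂ A a)
  obtain ⟨μ, -, hμ⟩ := (WeakDual.isCompact_closedBall (0 : StrongDual ℂ (A →L[ℂ] ℂ)) K
    ).ultrafilter_le_nhds (U.map J) (by
      rw [le_principal_iff]
      refine hU (hK.mono fun a ha => ?_)
      simp only [Set.mem_preimage, mem_closedBall_zero_iff]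
      exact (NormedSpace.double_dual_bound ℂ A a).trans ha)
  have hlim (ψ : A →L[ℂ] ℂ) : Tendsto (fun a => ψ a) U (𝓝 (μ ψ)) :=
    ((WeakDual.eval_continuous ψ).tendsto μ).comp hμ
  exact ⟨WeakDual.toStrongDual μ, fun ψ a =>
    ⟨tendsto_nhds_unique (hlim _) ((ψ.cont.tendsto a).comp ((hl.tendsto_mul_left a).mono_left hU)),
    tendsto_nhds_unique (hlim _)
      ((ψ.cont.tendsto a).comp ((hl.tendsto_mul_right a).mono_left hU))⟩⟩

end MixedIdentity

/-- A presentation of the algebra `A` as a direct factor of the algebra `D`: an inclusion of `A`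
as an ideal together with a multiplicative retraction `D → A` which determines the products of
elements of `D` and elements of the ideal. -/
structure DirectFactor (A D : Type*) [NonUnitalNormedRing A] [NormedSpace ℂ A]
    [NonUnitalNormedRing D] [NormedSpace ℂ D] where
  /-- The inclusion of the factor. -/
  incl : A →L[ℂ] D
  /-- The projection onto the factor. -/
  proj : D →L[ℂ] A
  proj_mul : ∀ c d, proj (c * d) = proj c * proj d
  proj_incl : ∀ a, proj (incl a) = a
  mul_incl : ∀ c a, c * incl a = incl (proj c * a)
  incl_mul_right : ∀ a c, incl a * c = incl (a * proj c)

namespace DirectFactor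

/-- Every algebra is a direct factor of itself. -/
protected def refl (A : Type*) [NonUnitalNormedRing A] [NormedSpace ℂ A] : DirectFactor A A where
  incl := .id ℂ A
  proj := .id ℂ A
  proj_mul _ _ := rfl
  proj_incl _ := rfl
  mul_incl _ _ := rfl
  incl_mul_right _ _ := rfl

variable {A D E : Type*} [NonUnitalNormedRing A] [NormedSpace ℂ A]
  [IsScalarTower ℂ A A] [SMulCommClass ℂ A A] [NonUnitalNormedRing D] [NormedSpace ℂ D]
  [IsScalarTower ℂ D D] [SMulCommClass ℂ D D] [NormedAddCommGroup E] [NormedSpace ℂ E]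

omit [IsScalarTower ℂ A A] [SMulCommClass ℂ A A] [IsScalarTower ℂ D D] [SMulCommClass ℂ D D] in
theorem incl_mul (F : DirectFactor A D) (a b : A) : F.incl (a * b) = F.incl a * F.incl b := by
  rw [F.mul_incl, F.proj_incl]

/-- The unit of a direct factor with a bounded approximate identity, as a virtual idempotent acting
on dual bimodules. The value of `φ : D → E*` is its weak* value at a mixed identity of the bidual
of the factor. -/
def unit (F : DirectFactor A D) (hA : HasBoundedApproxIdentity A) (M : BanachBimodule D E) :
    M.dual.VirtualIdempotent where
  eval := (ContinuousLinearMap.compL ℂ E (A →L[ℂ] ℂ) ℂ hA.exists_mixedIdentity.choose).comp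
    ((ContinuousLinearMap.flipₗᵢ ℂ A E ℂ).toContinuousLinearEquiv.toContinuousLinearMap.comp
      (F.incl.precomp (E →L[ℂ] ℂ)))
  proj := F.incl.comp F.proj
  proj_mul c d := by simp [F.proj_mul, F.incl_mul]
  proj_proj c := by simp [F.proj_incl]
  eval_comp_proj φ := by
    ext x
    refine congrArg hA.exists_mixedIdentity.choose ?_
    ext a
    exact congrArg (φ · x) (congrArg F.incl (F.proj_incl a))
  eval_mul_left φ c := by
    ext x
    refine Eq.trans (congrArg hA.exists_mixedIdentity.choose ?_)
      (hA.exists_mixedIdentity.choose_spec ((φ.comp F.incl).flip x) (F.proj c)).1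
    ext a
    exact congrArg (φ · x) (F.mul_incl c a)
  eval_mul_right φ c := by
    ext x
    refine Eq.trans (congrArg hA.exists_mixedIdentity.choose ?_)
      (hA.exists_mixedIdentity.choose_spec ((φ.comp F.incl).flip x) (F.proj c)).2
    ext a
    exact congrArg (φ · x) (F.incl_mul_right a c)
  eval_lact _ _ := rfl
  eval_ract _ _ := rfl

end DirectFactor

namespace BanachBimodule

/-! ### Consequences for cohomology -/

section HochschildMap

variable {D D₁ D₂ X X₁ X₂ : Type*}
  [NonUnitalNormedRing D] [NormedSpace ℂ D] [IsScalarTower ℂ D D] [SMulCommClass ℂ D D]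
  [NonUnitalNormedRing D₁] [NormedSpace ℂ D₁] [IsScalarTower ℂ D₁ D₁] [SMulCommClass ℂ D₁ D₁]
  [NonUnitalNormedRing D₂] [NormedSpace ℂ D₂] [IsScalarTower ℂ D₂ D₂] [SMulCommClass ℂ D₂ D₂]
  [NormedAddCommGroup X] [NormedSpace ℂ X] [NormedAddCommGroup X₁] [NormedSpace ℂ X₁]
  [NormedAddCommGroup X₂] [NormedSpace ℂ X₂]
  {N : BanachBimodule D X} {N₁ : BanachBimodule D₁ X₁} {N₂ : BanachBimodule D₂ X₂}
  {φ₁ : D₁ →L[ℂ] D} {u₁ : X →L[ℂ] X₁} {ψ₁ : D →L[ℂ] D₁} {v₁ : X₁ →L[ℂ] X}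
  {φ₂ : D₂ →L[ℂ] D} {u₂ : X →L[ℂ] X₂} {ψ₂ : D →L[ℂ] D₂} {v₂ : X₂ →L[ℂ] X}

/-- The isomorphism between the cohomology of `N` and the product of those of `N₁` and `N₂` given
by cochain maps in both directions which are mutually inverse up to coboundaries. -/
def hochschildEquivProdOfCochainMap (h₁ : IsCompatible N N₁ φ₁ u₁) (h₂ : IsCompatible N N₂ φ₂ u₂)
    (k₁ : IsCompatible N₁ N ψ₁ v₁) (k₂ : IsCompatible N₂ N ψ₂ v₂) (n : ℕ)
    (h : ∀ f ∈ N.cocycles n, f - (cochainMap ψ₁ v₁ n (cochainMap φ₁ u₁ n f) +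
      cochainMap ψ₂ v₂ n (cochainMap φ₂ u₂ n f)) ∈ N.coboundaries n)
    (h₁₁ : ∀ f ∈ N₁.cocycles n,
      f - cochainMap φ₁ u₁ n (cochainMap ψ₁ v₁ n f) ∈ N₁.coboundaries n)
    (h₂₂ : ∀ f ∈ N₂.cocycles n,
      f - cochainMap φ₂ u₂ n (cochainMap ψ₂ v₂ n f) ∈ N₂.coboundaries n)
    (h₁₂ : ∀ f, cochainMap φ₂ u₂ n (cochainMap ψ₁ v₁ n f) = 0)
    (h₂₁ : ∀ f, cochainMap φ₁ u₁ n (cochainMap ψ₂ v₂ n f) = 0) :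
    N.hochschild n ≃ₗ[ℂ] N₁.hochschild n × N₂.hochschild n where
  toLinearMap := (hochschildMap h₁ n).prod (hochschildMap h₂ n)
  invFun := (hochschildMap k₁ n).coprod (hochschildMap k₂ n)
  left_inv x := by
    obtain ⟨f, rfl⟩ := Submodule.Quotient.mk_surjective _ x
    refine ((Submodule.Quotient.eq _).2 ?_).symm
    exact h f f.2
  right_inv := fun ⟨x, y⟩ => by
    obtain ⟨f, rfl⟩ := Submodule.Quotient.mk_surjective _ x
    obtain ⟨g, rfl⟩ := Submodule.Quotient.mk_surjective _ y
    refine Prod.ext ?_ ?_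
    · refine ((Submodule.Quotient.eq _).2 ?_).symm
      change f.1 - cochainMap φ₁ u₁ n (cochainMap ψ₁ v₁ n f.1 + cochainMap ψ₂ v₂ n g.1) ∈
        N₁.coboundaries n
      rw [map_add, h₂₁, add_zero]
      exact h₁₁ f f.2
    · refine ((Submodule.Quotient.eq _).2 ?_).symm
      change g.1 - cochainMap φ₂ u₂ n (cochainMap ψ₁ v₁ n f.1 + cochainMap ψ₂ v₂ n g.1) ∈
        N₂.coboundaries n
      rw [map_add, h₁₂, zero_add]
      exact h₂₂ g g.2

end HochschildMap

namespace VirtualIdempotent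

variable {D X : Type*} [NonUnitalNormedRing D] [NormedSpace ℂ D]
  [IsScalarTower ℂ D D] [SMulCommClass ℂ D D] [NormedAddCommGroup X] [NormedSpace ℂ X]
  {N : BanachBimodule D X} (m : N.VirtualIdempotent)

/-- The projection `x ↦ m x m` of the bimodule. -/
def corner : X →L[ℂ] X := m.right.comp m.left

theorem corner_apply (x : X) : m.corner x = m.right (m.left x) := rfl

theorem corner_lact (c : D) (x : X) : m.corner (N.lact (m.proj c) x) = N.lact c (m.corner x) := by
  rw [corner_apply, corner_apply, left_lact, m.proj_proj, ← right_lact, lact_left]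

theorem corner_ract (c : D) (x : X) : m.corner (N.ract (m.proj c) x) = N.ract c (m.corner x) := by
  rw [corner_apply, corner_apply, left_ract, right_ract, m.proj_proj, ract_right]

/-- Left multiplication of a cocycle by `m` amounts, in cohomology, to multiplication by `m` of
each argument and of the value on both sides. -/
theorem left_sub_corner_mem_coboundaries {n : ℕ}
    {f : ContinuousMultilinearMap ℂ (fun _ : Fin (n + 1) => D) X} (hf : f ∈ N.cocycles (n + 1)) :
    cochainMap (.id ℂ D) m.left (n + 1) f - cochainMap m.proj m.corner (n + 1) f ∈
      N.coboundaries (n + 1) := by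
  have hg := m.isCompatible_left.map_cocycles (n + 1) hf
  rw [Submodule.mem_comap, cocycles, LinearMap.mem_ker] at hg
  refine ⟨m.prism n (cochainMap (.id ℂ D) m.left (n + 1) f), ?_⟩
  ext v
  have h := m.prism_homotopy (cochainMap (.id ℂ D) m.left (n + 1) f) (fun c v => by
    rw [cochainMap_apply, lact_left, lact_left, m.proj_proj]) v
  rw [hg, map_zero, zero_apply, zero_add, cochainMap_apply, left_left] at h
  exact h

/-- If `m` is a unit, then left multiplication by `m` is the identity on cohomology in positive
degrees. -/
theorem sub_left_mem_coboundaries (hm : ∀ c, m.proj c = c) {n : ℕ}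
    {f : ContinuousMultilinearMap ℂ (fun _ : Fin (n + 1) => D) X} (hf : f ∈ N.cocycles (n + 1)) :
    f - cochainMap (.id ℂ D) m.left (n + 1) f ∈ N.coboundaries (n + 1) := by
  have hg : N.coboundary (n + 1) (f - cochainMap (.id ℂ D) m.left (n + 1) f) = 0 :=
    (N.cocycles (n + 1)).sub_mem hf (m.isCompatible_left.map_cocycles (n + 1) hf)
  have h := m.insertHead_homotopy hm (f - cochainMap (.id ℂ D) m.left (n + 1) f) fun c v => by
    rw [sub_apply, map_sub, cochainMap_apply, lact_left, hm]
    exact sub_self _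
  rw [hg, map_zero, zero_add] at h
  rw [← neg_mem_iff]
  exact ⟨_, h⟩

theorem sub_corner_mem_coboundaries (hm : ∀ c, m.proj c = c) {n : ℕ}
    {f : ContinuousMultilinearMap ℂ (fun _ : Fin (n + 1) => D) X} (hf : f ∈ N.cocycles (n + 1)) :
    f - cochainMap (.id ℂ D) m.corner (n + 1) f ∈ N.coboundaries (n + 1) := by
  have h := add_mem (m.sub_left_mem_coboundaries hm hf) (m.left_sub_corner_mem_coboundaries hf)
  rwa [sub_add_sub_cancel, show m.proj = .id ℂ D from ContinuousLinearMap.ext hm] at h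

end VirtualIdempotent

/-! ### Cohomology of a direct product -/

variable {A B D E : Type*} [NonUnitalNormedRing A] [NormedSpace ℂ A]
  [IsScalarTower ℂ A A] [SMulCommClass ℂ A A] [NonUnitalNormedRing B] [NormedSpace ℂ B]
  [IsScalarTower ℂ B B] [SMulCommClass ℂ B B] [NonUnitalNormedRing D] [NormedSpace ℂ D]
  [IsScalarTower ℂ D D] [SMulCommClass ℂ D D] [NormedAddCommGroup E] [NormedSpace ℂ E]
  (M : BanachBimodule D E) (F : DirectFactor A D) (G : DirectFactor B D)
  (hA : HasBoundedApproxIdentity A) (hB : HasBoundedApproxIdentity B)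

/-- The bimodule over a direct factor obtained by restriction. -/
abbrev restrictFactor : BanachBimodule A E := M.restrict F.incl F.incl_mul

omit [IsScalarTower ℂ A A] [SMulCommClass ℂ A A] [IsScalarTower ℂ D D] [SMulCommClass ℂ D D] in
theorem isCompatible_incl :
    IsCompatible M.dual (M.restrictFactor F).dual F.incl (.id ℂ (E →L[ℂ] ℂ)) where
  map_mul := F.incl_mul
  map_lact _ _ := rfl
  map_ract _ _ := rfl

/-- Cochains on a factor extend to cochains on `D` by the projection, once their values are
multiplied by the unit of the factor on both sides: this makes the complementary factor act
trivially on them. -/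
theorem isCompatible_proj :
    IsCompatible (M.restrictFactor F).dual M.dual F.proj (F.unit hA M).corner where
  map_mul := F.proj_mul
  map_lact := (F.unit hA M).corner_lact
  map_ract := (F.unit hA M).corner_ract

/-- Extending a cocycle from a factor to `D` and restricting it again does not change its class. -/
theorem sub_restrict_extend_mem_coboundaries {n : ℕ}
    {f : ContinuousMultilinearMap ℂ (fun _ : Fin (n + 1) => A) (E →L[ℂ] ℂ)}
    (hf : f ∈ (M.restrictFactor F).dual.cocycles (n + 1)) :
    f - cochainMap F.incl (.id ℂ _) (n + 1) (cochainMap F.proj (F.unit hA M).corner (n + 1) f) ∈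
      (M.restrictFactor F).dual.coboundaries (n + 1) := by
  have h := ((DirectFactor.refl A).unit hA (M.restrictFactor F)).sub_corner_mem_coboundaries
    (fun _ => rfl) hf
  have h' : cochainMap F.incl (.id ℂ _) (n + 1)
      (cochainMap F.proj (F.unit hA M).corner (n + 1) f) =
      cochainMap (.id ℂ A) ((DirectFactor.refl A).unit hA (M.restrictFactor F)).corner
        (n + 1) f := by
    ext1 v
    have hv : F.proj ∘ F.incl ∘ v = v := funext fun i => F.proj_incl (v i)
    simp only [cochainMap_apply, hv]
    rfl
  rwa [h']

/-- If `D` is the sum of the two factors and `E · D` spans a dense subspace of `E`, then the left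
actions of the two units on `E*` add up to the identity. -/
theorem left_add_left (hM : Dense (Submodule.span ℂ {y : E | ∃ (a : D) (x : E), M.ract a x = y} :
      Set E)) (h : ∀ c, F.incl (F.proj c) + G.incl (G.proj c) = c) (g : E →L[ℂ] ℂ) :
    (F.unit hA M).left g + (G.unit hB M).left g = g := by
  refine ContinuousLinearMap.ext_on hM ?_
  rintro _ ⟨c, x, rfl⟩
  have hF := congrArg (· x) ((F.unit hA M).lact_left c g)
  have hG := congrArg (· x) ((G.unit hB M).lact_left c g)
  have hc := congrArg (fun d => M.dual.lact d g x) (h c)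
  simp only [map_add, add_apply] at hc
  exact (congrArg₂ (· + ·) hF hG).trans hc

/-- A cocycle on the product is cohomologous to the sum of the extensions of its restrictions to
the two factors. -/
theorem sub_extend_restrict_mem_coboundaries
    (hM : Dense (Submodule.span ℂ {y : E | ∃ (a : D) (x : E), M.ract a x = y} : Set E))
    (h : ∀ c, F.incl (F.proj c) + G.incl (G.proj c) = c) {n : ℕ}
    {f : ContinuousMultilinearMap ℂ (fun _ : Fin (n + 1) => D) (E →L[ℂ] ℂ)}
    (hf : f ∈ M.dual.cocycles (n + 1)) :
    f - (cochainMap F.proj (F.unit hA M).corner (n + 1) (cochainMap F.incl (.id ℂ _) (n + 1) f)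
      + cochainMap G.proj (G.unit hB M).corner (n + 1) (cochainMap G.incl (.id ℂ _) (n + 1) f)) ∈
      M.dual.coboundaries (n + 1) := by
  have h1 := add_mem ((F.unit hA M).left_sub_corner_mem_coboundaries hf)
    ((G.unit hB M).left_sub_corner_mem_coboundaries hf)
  rw [sub_add_sub_comm] at h1
  have h2 : cochainMap (.id ℂ D) (F.unit hA M).left (n + 1) f +
      cochainMap (.id ℂ D) (G.unit hB M).left (n + 1) f = f := by
    ext1 v
    exact M.left_add_left F G hA hB hM h _
  rw [h2] at h1
  exact h1

omit [IsScalarTower ℂ A A] [SMulCommClass ℂ A A] [IsScalarTower ℂ B B] [SMulCommClass ℂ B B]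
  [IsScalarTower ℂ D D] [SMulCommClass ℂ D D] in
/-- In positive degrees, a cochain extended from one factor vanishes on the complementary factor. -/
theorem cochainMap_incl_cochainMap_proj (h : ∀ b, F.proj (G.incl b) = 0)
    (u : (E →L[ℂ] ℂ) →L[ℂ] E →L[ℂ] ℂ) {n : ℕ}
    (f : ContinuousMultilinearMap ℂ (fun _ : Fin (n + 1) => A) (E →L[ℂ] ℂ)) :
    cochainMap G.incl (.id ℂ _) (n + 1) (cochainMap F.proj u (n + 1) f) = 0 := by
  ext1 v
  have hv : F.proj ∘ G.incl ∘ v = 0 := funext fun i => h (v i)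
  simp only [cochainMap_apply, hv, f.map_zero, map_zero]
  rfl

/-- If `D` is the direct product of `A` and `B`, then restriction of cochains to the two factors
is an isomorphism from the cohomology of `D` in positive degrees. -/
def hochschildEquivProd
    (hM : Dense (Submodule.span ℂ {y : E | ∃ (a : D) (x : E), M.ract a x = y} : Set E))
    (h : ∀ c, F.incl (F.proj c) + G.incl (G.proj c) = c) (hFG : ∀ b, F.proj (G.incl b) = 0)
    (hGF : ∀ a, G.proj (F.incl a) = 0) (n : ℕ) :
    M.dual.hochschild (n + 1) ≃ₗ[ℂ]
      (M.restrictFactor F).dual.hochschild (n + 1) ×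
        (M.restrictFactor G).dual.hochschild (n + 1) :=
  hochschildEquivProdOfCochainMap (M.isCompatible_incl F) (M.isCompatible_incl G)
    (M.isCompatible_proj F hA) (M.isCompatible_proj G hB) (n + 1)
    (fun _ hf => M.sub_extend_restrict_mem_coboundaries F G hA hB hM h hf)
    (fun _ hf => M.sub_restrict_extend_mem_coboundaries F hA hf)
    (fun _ hf => M.sub_restrict_extend_mem_coboundaries G hB hf)
    (cochainMap_incl_cochainMap_proj F G hFG _) (cochainMap_incl_cochainMap_proj G F hGF _)

end BanachBimodule

/-! ### The direct factors of the Lau product -/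

namespace LauProduct

variable {A B : Type*} [NonUnitalNormedRing A] [NormedSpace ℂ A]
  [NonUnitalNormedRing B] [NormedSpace ℂ B]

/-- The projection `(a, b) ↦ a + T(b)` of `A ×_T B` onto its direct factor `A`. -/
def addL (T : B →ₙₐ[ℂ] A) (hT : ∀ b, ‖T b‖ ≤ ‖b‖) : LauProduct T hT →L[ℂ] A :=
  LinearMap.mkContinuous
    { toFun := fun x => x.fst + T x.snd
      map_add' := fun x y => by
        simp only [fst_add, snd_add, map_add]
        abel
      map_smul' := fun c x => by simp [fst_smul, snd_smul] }
    1 (fun x => by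
      have h := hT x.snd
      have h' := norm_add_le x.fst (T x.snd)
      simp only [LinearMap.coe_mk, AddHom.coe_mk, norm_eq]
      linarith)

/-- The projection `(a, b) ↦ b` of `A ×_T B` onto its direct factor `B`. -/
def sndL (T : B →ₙₐ[ℂ] A) (hT : ∀ b, ‖T b‖ ≤ ‖b‖) : LauProduct T hT →L[ℂ] B :=
  LinearMap.mkContinuous
    { toFun := snd
      map_add' := snd_add
      map_smul' := snd_smul }
    1 (fun x => by
      have h := norm_nonneg x.fst
      change ‖x.snd‖ ≤ _
      rw [norm_eq]
      linarith)

theorem addL_apply (T : B →ₙₐ[ℂ] A) (hT : ∀ b, ‖T b‖ ≤ ‖b‖) (x : LauProduct T hT) :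
    addL T hT x = x.fst + T x.snd := rfl

theorem sndL_apply (T : B →ₙₐ[ℂ] A) (hT : ∀ b, ‖T b‖ ≤ ‖b‖) (x : LauProduct T hT) :
    sndL T hT x = x.snd := rfl

theorem inlL_apply (T : B →ₙₐ[ℂ] A) (hT : ∀ b, ‖T b‖ ≤ ‖b‖) (a : A) :
    inlL T hT a = mk a 0 := rfl

theorem inrL_apply (T : B →ₙₐ[ℂ] A) (hT : ∀ b, ‖T b‖ ≤ ‖b‖) (b : B) :
    inrL T hT b = mk (-T b) b := rfl

/-- The ideal `{(a, 0)}` of `A ×_T B` as a direct factor. -/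
def leftFactor (T : B →ₙₐ[ℂ] A) (hT : ∀ b, ‖T b‖ ≤ ‖b‖) : DirectFactor A (LauProduct T hT) where
  incl := inlL T hT
  proj := addL T hT
  proj_mul c d := by
    simp only [addL_apply, fst_mul, snd_mul, mul_add, add_mul, map_mul]
    abel
  proj_incl a := by simp [inlL_apply, addL_apply, fst_mk, snd_mk]
  mul_incl c a := by
    apply ext' <;> simp [inlL_apply, addL_apply, fst_mk, snd_mk, fst_mul, snd_mul, add_mul]
  incl_mul_right a c := by
    apply ext' <;> simp [inlL_apply, addL_apply, fst_mk, snd_mk, fst_mul, snd_mul, mul_add]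

/-- The ideal `{(-T(b), b)}` of `A ×_T B` as a direct factor. -/
def rightFactor (T : B →ₙₐ[ℂ] A) (hT : ∀ b, ‖T b‖ ≤ ‖b‖) : DirectFactor B (LauProduct T hT) where
  incl := inrL T hT
  proj := sndL T hT
  proj_mul c d := rfl
  proj_incl a := rfl
  mul_incl c a := by
    apply ext' <;> simp [inrL_apply, sndL_apply, fst_mk, snd_mk, fst_mul, snd_mul]
  incl_mul_right a c := by
    apply ext' <;> simp [inrL_apply, sndL_apply, fst_mk, snd_mk, fst_mul, snd_mul]

theorem incl_proj_add_incl_proj (T : B →ₙₐ[ℂ] A) (hT : ∀ b, ‖T b‖ ≤ ‖b‖) (c : LauProduct T hT) :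
    (leftFactor T hT).incl ((leftFactor T hT).proj c) +
      (rightFactor T hT).incl ((rightFactor T hT).proj c) = c := by
  apply ext' <;> simp [leftFactor, rightFactor, addL_apply, sndL_apply, inlL_apply, inrL_apply,
    fst_add, snd_add, fst_mk, snd_mk]

end LauProduct
end

theorem mainTheorem6 {A B E : Type*}
    [NonUnitalNormedRing A] [NormedSpace ℂ A] [IsScalarTower ℂ A A] [SMulCommClass ℂ A A]
    [CompleteSpace A]
    [NonUnitalNormedRing B] [NormedSpace ℂ B] [IsScalarTower ℂ B B] [SMulCommClass ℂ B B]
    [CompleteSpace B]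
    [NormedAddCommGroup E] [NormedSpace ℂ E] [CompleteSpace E]
    (hA : HasBoundedApproxIdentity A) (hB : HasBoundedApproxIdentity B)
    (T : B →ₙₐ[ℂ] A) (hT : ∀ b, ‖T b‖ ≤ ‖b‖)
    (M : BanachBimodule (LauProduct T hT) E) (hM : M.IsEssential)
    (n : ℕ) (hn : 1 ≤ n) :
    Nonempty (M.dual.hochschild n ≃ₗ[ℂ]
      M.toLeftFactor.dual.hochschild n × M.toRightFactor.dual.hochschild n) := by
  obtain ⟨n, rfl⟩ := Nat.exists_eq_add_of_le' hn
  exact ⟨M.hochschildEquivProd (LauProduct.leftFactor T hT) (LauProduct.rightFactor T hT) hA hB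
    hM.2 (LauProduct.incl_proj_add_incl_proj T hT) (fun b => neg_add_cancel (T b)) (fun _ => rfl) n⟩
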